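/- Write $(a;q)_n=\prod_{i=0}^{n-1}(1-aq^i)$ for $n\ge 0$, $(a;q)_\infty=\lim_{n\to\infty}(a;q)_n=\prod_{i\ge 0}(1-aq^i)$, and $(a_1,a_2;q)_\infty=(a_1;q)_\infty(a_2;q)_\infty$. Then $$\sum_{m,n\ge 0}\frac{q^{2m^2+6mn+6n^2}}{(q;q)_m\,(q^3;q^3)_n}=(-q^2,-q^4;q^6)_\infty\,(-q^3;q^3)_\infty .$$ This holds for every complex number $q$ with $|q|<1$, where the double series converges absolutely, and it also holds as an identity of formal power series in $q$ with integer coefficients, where the sum and the infinite products converge coefficientwise. -/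

import Mathlib

open Filter Topology PowerSeries
open scoped PowerSeries.WithPiTopology

/-- The finite `q`-Pochhammer symbol `(a; q)_n = (1 - a)(1 - a q) ⋯ (1 - a q ^ (n - 1))`. -/
def qPochhammer {R : Type*} [CommRing R] (a q : R) (n : ℕ) : R :=
  ∏ i ∈ Finset.range n, (1 - a * q ^ i)

/-- The infinite `q`-Pochhammer symbol `(a; q)_∞ = ∏ (1 - a q ^ i)` over all `i ≥ 0`.
In the two settings used here it is the limit of `(a; q)_n`; see
`tendsto_qPochhammer_complex` and `tendsto_qPochhammer_formal` below. -/
noncomputable def qPochhammerInf {R : Type*} [CommRing R] [TopologicalSpace R] (a q : R) : R :=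
  ∏' i : ℕ, (1 - a * q ^ i)

/-- For complex `|q| < 1` the infinite symbol is the limit of the finite ones. -/
theorem tendsto_qPochhammer_complex (a q : ℂ) (hq : ‖q‖ < 1) :
    Tendsto (qPochhammer a q) atTop (𝓝 (qPochhammerInf a q)) := by
  have hs : Summable (fun i : ℕ => ‖-(a * q ^ i)‖) := by
    simpa [norm_mul, norm_pow] using
      (summable_geometric_of_lt_one (norm_nonneg q) hq).mul_left ‖a‖
  have hm : Multipliable (fun i : ℕ => 1 - a * q ^ i) := by
    simpa [sub_eq_add_neg] using multipliable_one_add_of_summable hs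
  exact hm.hasProd.tendsto_prod_nat

/-- For formal power series with integer coefficients and `q` without constant term, the infinite
symbol is the (coefficientwise) limit of the finite ones. -/
theorem tendsto_qPochhammer_formal (a q : ℤ⟦X⟧) (hq : constantCoeff q = 0) :
    Tendsto (qPochhammer a q) atTop (𝓝 (qPochhammerInf a q)) := by
  have hm : Multipliable (fun i : ℕ => 1 + -(a * q ^ i)) := by
    refine WithPiTopology.multipliable_one_add_of_tendsto_order_atTop_nhds_top _ ?_
    rw [ENat.tendsto_nhds_top_iff_natCast_lt]
    intro n
    filter_upwards [eventually_gt_atTop n] with i hi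
    rw [order_neg]
    refine lt_of_lt_of_le (by exact_mod_cast hi : (n : ℕ∞) < i) ?_
    refine le_trans (le_order_pow_of_constantCoeff_eq_zero i hq) ?_
    exact le_trans le_add_self (le_order_mul _ _)
  have h := hm.hasProd.tendsto_prod_nat
  simp only [← sub_eq_add_neg] at h
  exact h

/-- For complex `|q| < 1` the denominators `(q ^ k; q ^ k)_n`, `k ≥ 1`, do not vanish. -/
theorem qPochhammer_self_ne_zero (q : ℂ) (hq : ‖q‖ < 1) {k : ℕ} (hk : k ≠ 0) (n : ℕ) :
    qPochhammer (q ^ k) (q ^ k) n ≠ 0 := by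
  refine Finset.prod_ne_zero_iff.mpr fun i _ h => ?_
  have h1 : q ^ (k + k * i) = 1 := by
    rw [pow_add, pow_mul]; exact (sub_eq_zero.mp h).symm
  have h2 : ‖q‖ ^ (k + k * i) = 1 := by rw [← norm_pow, h1, norm_one]
  exact (pow_lt_one₀ (norm_nonneg q) hq (by omega)).ne h2

/-- The formal denominators `(X ^ k; X ^ k)_n`, `k ≥ 1`, are invertible power series. -/
theorem isUnit_qPochhammer_self {k : ℕ} (hk : k ≠ 0) (n : ℕ) :
    IsUnit (qPochhammer (X ^ k : ℤ⟦X⟧) (X ^ k) n) := by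
  rw [PowerSeries.isUnit_iff_constantCoeff]
  simp [qPochhammer, map_prod, hk]

/-! ### Euler series in an auxiliary variable u and their q-difference equations -/

section FunctionalEquations

variable {R : Type*} [CommRing R]

/-! Since 2m² + 6mn + 6n² = 3·C(m+2n,2) + C(m,2) + 2m + 3n, the double series is ∑ₖ q^(3·C(k,2))
[u^k] F with F = (-q²u;q)_∞ / (q³u²;q³)_∞. Splitting exponents into residue classes and cancelling
(-q³u;q³)_∞ gives F = H / (q³u;q³)_∞, where H = (-q²u,-q⁴u;q³)_∞ / (q³u²;q⁶)_∞
(`eulerExp_mul_eulerInvSq`).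

Write k = i + j, with i from 1/(q³u;q³)_∞ and j from H. By `pow_choose_mul_coeff_eulerExp`,
q^(3·C(j,2)) [u^j] H = (-q³;q³)_j [u^j] (-q²u,-q⁴u;q⁶)_∞. The cross term ij in C(i+j,2) turns the
sum over i into Euler's series for (-q^(3j+3);q³)_∞, which completes (-q³;q³)_j to (-q³;q³)_∞ for
every j. The remaining sum over j is (-q²u,-q⁴u;q⁶)_∞ at u = 1.

The series in u are formal; convergence matters only for the rearrangements and for u = 1.
`IsBoundedFamilyRing` isolates the summability needed, so that one argument serves both settings. -/

theorem qPochhammer_succ (a q : R) (n : ℕ) :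
    qPochhammer a q (n + 1) = qPochhammer a q n * (1 - a * q ^ n) :=
  Finset.prod_range_succ _ _

theorem choose_succ_two (n : ℕ) : (n + 1).choose 2 = n + n.choose 2 := by
  rw [Nat.choose_succ_succ' n 1, Nat.choose_one_right]

theorem choose_add_two (m n : ℕ) : (m + n).choose 2 = m.choose 2 + n.choose 2 + m * n := by
  induction n with
  | zero => simp
  | succ n ih => rw [← add_assoc, choose_succ_two, choose_succ_two, ih]; ring

/-- The reciprocal `1 / (t; t)_n`. -/
noncomputable def qPochhammerInv (t : R) (n : ℕ) : R := Ring.inverse (qPochhammer t t n)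

@[simp] theorem qPochhammerInv_zero (t : R) : qPochhammerInv t 0 = 1 := by
  simp [qPochhammerInv, qPochhammer]

theorem qPochhammerInv_eq_succ {t : R} (ht : ∀ n, IsUnit (1 - t ^ (n + 1))) (n : ℕ) :
    qPochhammerInv t n = (1 - t ^ (n + 1)) * qPochhammerInv t (n + 1) := by
  rw [qPochhammerInv, qPochhammerInv, qPochhammer_succ, Ring.mul_inverse_rev, ← pow_succ',
    ← mul_assoc, Ring.mul_inverse_cancel _ (ht n), one_mul]

/-- The expansion of `(-x u; t)_∞` in powers of `u`. -/
noncomputable def eulerExp (t x : R) : R⟦X⟧ :=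
  mk fun n => t ^ n.choose 2 * x ^ n * qPochhammerInv t n

/-- The expansion of `1 / (x u; t)_∞` in powers of `u`. -/
noncomputable def eulerInv (t x : R) : R⟦X⟧ :=
  mk fun n => x ^ n * qPochhammerInv t n

/-- The expansion of `1 / (x u ^ 2; t)_∞` in powers of `u`. -/
noncomputable def eulerInvSq (t x : R) : R⟦X⟧ :=
  mk fun n => if Even n then x ^ (n / 2) * qPochhammerInv t (n / 2) else 0

theorem coeff_zero_linear_mul (x : R) (F : R⟦X⟧) : coeff 0 ((1 + C x * X) * F) = coeff 0 F := by
  simp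

theorem coeff_succ_linear_mul (x : R) (F : R⟦X⟧) (n : ℕ) :
    coeff (n + 1) ((1 + C x * X) * F) = coeff (n + 1) F + x * coeff n F := by
  rw [add_mul, one_mul, map_add, mul_assoc, coeff_C_mul, coeff_succ_X_mul]

theorem coeff_add_two_quadratic_mul (x y : R) (F : R⟦X⟧) (n : ℕ) :
    coeff (n + 2) ((1 + C x * X + C y * X ^ 2) * F) =
      coeff (n + 2) F + x * coeff (n + 1) F + y * coeff n F := by
  rw [add_mul, map_add, coeff_succ_linear_mul, mul_assoc, coeff_C_mul, coeff_X_pow_mul]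

theorem coeff_one_quadratic_mul (x y : R) (F : R⟦X⟧) :
    coeff 1 ((1 + C x * X + C y * X ^ 2) * F) = coeff 1 F + x * coeff 0 F := by
  rw [add_mul, map_add, coeff_succ_linear_mul, mul_assoc, coeff_C_mul, coeff_X_pow_mul']
  simp

theorem rescale_eulerExp (s t x : R) : rescale s (eulerExp t x) = eulerExp t (s * x) := by
  ext n; simp only [coeff_rescale, eulerExp, coeff_mk]; ring

theorem rescale_eulerInv (s t x : R) : rescale s (eulerInv t x) = eulerInv t (s * x) := by
  ext n; simp only [coeff_rescale, eulerInv, coeff_mk]; ring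

theorem rescale_eulerInvSq (s t x : R) :
    rescale s (eulerInvSq t x) = eulerInvSq t (s ^ 2 * x) := by
  ext n
  simp only [coeff_rescale, eulerInvSq, coeff_mk]
  split_ifs with h
  · obtain ⟨m, rfl⟩ := h
    rw [← two_mul, Nat.mul_div_cancel_left _ two_pos]; ring
  · simp

theorem eulerExp_eq {t : R} (ht : ∀ n, IsUnit (1 - t ^ (n + 1))) (x : R) :
    eulerExp t x = (1 + C x * X) * eulerExp t (t * x) := by
  ext n
  rcases n with _ | n
  · simp [eulerExp]
  · simp only [coeff_succ_linear_mul, eulerExp, coeff_mk, qPochhammerInv_eq_succ ht n,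
      choose_succ_two]
    ring

theorem eulerInv_eq {t : R} (ht : ∀ n, IsUnit (1 - t ^ (n + 1))) (x : R) :
    (1 + C (-x) * X) * eulerInv t x = eulerInv t (t * x) := by
  ext n
  rcases n with _ | n
  · simp [eulerInv]
  · simp only [coeff_succ_linear_mul, eulerInv, coeff_mk, qPochhammerInv_eq_succ ht n]
    ring

theorem eulerInvSq_eq {t : R} (ht : ∀ n, IsUnit (1 - t ^ (n + 1))) (x : R) :
    (1 + C (-x) * X ^ 2) * eulerInvSq t x = eulerInvSq t (t * x) := by
  have h0 : (1 + C (-x) * X ^ 2 : R⟦X⟧) = 1 + C 0 * X + C (-x) * X ^ 2 := by simp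
  rw [h0]
  ext n
  rcases n with _ | _ | n
  · simp [eulerInvSq]
  · rw [coeff_one_quadratic_mul]; simp [eulerInvSq]
  · rw [coeff_add_two_quadratic_mul]
    simp only [eulerInvSq, coeff_mk]
    rcases Nat.even_or_odd n with h | h
    · have h2 : Even (n + 2) := h.add even_two
      obtain ⟨m, rfl⟩ := h
      have h3 : (m + m + 2) / 2 = m + 1 := by omega
      have h4 : (m + m) / 2 = m := by omega
      simp only [h2, if_true, h3, h4, Even.add_self, qPochhammerInv_eq_succ ht m]
      ring
    · have h1 : ¬ Even n := Nat.not_even_iff_odd.mpr h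
      have h2 : ¬ Even (n + 2) := by simpa [Nat.even_add] using h1
      simp [h1, h2]

/-- A `q`-difference equation `A(u) F(u) = B(u) F(p u)` has at most one power series solution with
given constant term. -/
theorem qDifference_unique {p : R} (hp : ∀ n, IsUnit (1 - p ^ (n + 1))) {A B F G : R⟦X⟧}
    (hA : coeff 0 A = 1) (hB : coeff 0 B = 1) (hF : A * F = B * rescale p F)
    (hG : A * G = B * rescale p G) (h0 : coeff 0 F = coeff 0 G) : F = G := by
  rw [← sub_eq_zero]
  have hD : A * (F - G) = B * rescale p (F - G) := by rw [map_sub, mul_sub, mul_sub, hF, hG]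
  have h0' : coeff 0 (F - G) = 0 := by rw [map_sub, h0, sub_self]
  generalize F - G = D at hD h0'
  have key (E D : R⟦X⟧) (n : ℕ) (hE : coeff 0 E = 1) (h : ∀ m < n, coeff m D = 0) :
      coeff n (E * D) = coeff n D := by
    rw [coeff_mul, Finset.sum_eq_single (0, n)]
    · rw [hE, one_mul]
    · rintro ⟨i, j⟩ hij hne
      rw [Finset.HasAntidiagonal.mem_antidiagonal] at hij
      simp only at hij
      rw [h j, mul_zero]
      rcases Nat.eq_zero_or_pos i with rfl | hi
      · exact absurd (by simpa using hij) (by simpa using hne)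
      · omega
    · simp
  ext n
  induction n using Nat.strong_induction_on with
  | _ n ih =>
    rcases n with _ | n
    · simpa using h0'
    -- Degree n + 1 reads D_{n+1} = p^(n+1) D_{n+1}, and 1 - p^(n+1) is a unit.
    · have h1 := congrArg (coeff (n + 1)) hD
      rw [key A D _ hA ih, key B _ _ hB fun m hm => by rw [coeff_rescale, ih m hm]; simp,
        coeff_rescale, ← sub_eq_zero, ← one_sub_mul] at h1
      simpa using (hp n).mul_right_eq_zero.mp h1

/-- `(-q^2 u; q)_∞ / (q^3 u^2; q^3)_∞` equals
`(-q^2 u, -q^4 u; q^3)_∞ / ((q^3 u; q^3)_∞ (q^3 u^2; q^6)_∞)`. -/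
theorem eulerExp_mul_eulerInvSq {q : R} (hq : ∀ n, IsUnit (1 - q ^ (n + 1))) :
    eulerExp q (q ^ 2) * eulerInvSq (q ^ 3) (q ^ 3) =
      eulerInv (q ^ 3) (q ^ 3) *
        (eulerExp (q ^ 3) (q ^ 2) * eulerExp (q ^ 3) (q ^ 4) * eulerInvSq (q ^ 6) (q ^ 3)) := by
  have hq3 : ∀ n, IsUnit (1 - (q ^ 3) ^ (n + 1)) := fun n => by
    rw [← pow_mul]; exact hq (3 * n + 2)
  have hq6 : ∀ n, IsUnit (1 - (q ^ 6) ^ (n + 1)) := fun n => by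
    rw [← pow_mul]; exact hq (6 * n + 5)
  refine qDifference_unique hq3
    (A := (1 + C (-q ^ 3) * X) * (1 + C (-q ^ 3) * X ^ 2))
    (B := (1 + C (q ^ 2) * X) * (1 + C (q ^ 4) * X)) (by simp) (by simp) ?_ ?_ ?_
  -- Replacing u by q³u removes (1+q²u)(1+q³u)(1+q⁴u) from the numerator and (1-q³u²)(1-q⁶u²) from
  -- the denominator. The common factor of 1+q³u and 1-q⁶u² = (1-q³u)(1+q³u) must be restored before
  -- comparing.
  · have hu : IsUnit (1 + C (q ^ 3) * X : R⟦X⟧) := by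
      rw [PowerSeries.isUnit_iff_constantCoeff]; simp
    refine hu.mul_left_cancel ?_
    have e1 := eulerExp_eq hq (q ^ 2)
    have e2 := eulerExp_eq hq (q * q ^ 2)
    have e3 := eulerExp_eq hq (q * (q * q ^ 2))
    have j1 := eulerInvSq_eq hq3 (q ^ 3)
    have j2 := eulerInvSq_eq hq3 (q ^ 3 * q ^ 3)
    rw [map_mul, rescale_eulerExp, rescale_eulerInvSq,
      show (q ^ 3) ^ 2 * q ^ 3 = q ^ 3 * (q ^ 3 * q ^ 3) by ring, ← j2, ← j1, e1, e2, e3,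
      show q * (q * (q * q ^ 2)) = q ^ 3 * q ^ 2 by ring]
    simp only [map_mul, map_pow, map_neg]
    ring
  · have i1 := eulerInv_eq hq3 (q ^ 3)
    have a1 := eulerExp_eq hq3 (q ^ 2)
    have b1 := eulerExp_eq hq3 (q ^ 4)
    have j1 := eulerInvSq_eq hq6 (q ^ 3)
    simp only [map_mul (rescale _), rescale_eulerExp, rescale_eulerInv, rescale_eulerInvSq]
    rw [show (q ^ 3) ^ 2 * q ^ 3 = q ^ 6 * q ^ 3 by ring, ← j1, ← i1, a1, b1]
    ring
  · simp [eulerExp, eulerInv, eulerInvSq]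

/-- For `a b = p^2`, the coefficient of `u^n` in `(-a u, -b u; p)_∞ / (p u^2; p^2)_∞` is, up to the
factor `p^(n(n-1)/2) / (-p; p)_n`, the one in `(-a u, -b u; p^2)_∞`. -/
theorem pow_choose_mul_coeff_eulerExp {p a b : R} (hp : ∀ n, IsUnit (1 - p ^ (n + 1)))
    (hab : a * b = p ^ 2) (n : ℕ) :
    p ^ n.choose 2 * coeff n (eulerExp p a * eulerExp p b * eulerInvSq (p ^ 2) p) =
      qPochhammer (-p) p n * coeff n (eulerExp (p ^ 2) a * eulerExp (p ^ 2) b) := by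
  have hp2 : ∀ n, IsUnit (1 - (p ^ 2) ^ (n + 1)) := fun n => by
    rw [← pow_mul]; exact hp (2 * n + 1)
  -- Call the two series h and e. Then (1-pu²)h(u) = (1+au)(1+bu)h(pu) and e(u) =
  -- (1+au)(1+bu)e(p²u). Hence y_n = p^C(n,2) h_n and y_n = (-p;p)_n e_n both satisfy (1-p^(n+2))
  -- y_{n+2} = p^(2n+2) ((a+b) y_{n+1} + (1+p^(n+1)) y_n).
  have hh : (1 + C 0 * X + C (-p) * X ^ 2) *
      (eulerExp p a * eulerExp p b * eulerInvSq (p ^ 2) p) =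
      (1 + C (a + b) * X + C (p ^ 2) * X ^ 2) *
        rescale p (eulerExp p a * eulerExp p b * eulerInvSq (p ^ 2) p) := by
    simp only [map_mul (rescale _), rescale_eulerExp, rescale_eulerInvSq]
    rw [← eulerInvSq_eq hp2, eulerExp_eq hp a, eulerExp_eq hp b, ← hab]
    simp only [map_mul, map_add, map_zero]
    ring
  have he : (1 + C 0 * X + C 0 * X ^ 2) * (eulerExp (p ^ 2) a * eulerExp (p ^ 2) b) =
      (1 + C (a + b) * X + C (p ^ 2) * X ^ 2) *
        rescale (p ^ 2) (eulerExp (p ^ 2) a * eulerExp (p ^ 2) b) := by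
    simp only [map_mul (rescale _), rescale_eulerExp]
    rw [eulerExp_eq hp2 a, eulerExp_eq hp2 b, ← hab]
    simp only [map_mul, map_add, map_zero]
    ring
  have h0 : coeff 0 (eulerExp p a * eulerExp p b * eulerInvSq (p ^ 2) p) = 1 := by
    simp [eulerExp, eulerInvSq]
  have e0 : coeff 0 (eulerExp (p ^ 2) a * eulerExp (p ^ 2) b) = 1 := by
    simp [eulerExp]
  generalize eulerExp p a * eulerExp p b * eulerInvSq (p ^ 2) p = h at *
  generalize eulerExp (p ^ 2) a * eulerExp (p ^ 2) b = e at *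
  induction n using Nat.twoStepInduction with
  | zero => simp [qPochhammer, h0, e0]
  | one =>
    have h1 := congrArg (coeff 1) hh
    have e1 := congrArg (coeff 1) he
    simp only [coeff_one_quadratic_mul, coeff_rescale, h0, e0] at h1 e1
    refine (hp 0).mul_left_cancel ?_
    simp only [qPochhammer, Finset.prod_range_one, Nat.choose_succ_self, zero_add]
    linear_combination h1 - e1
  | more n ih1 ih2 =>
    have h1 := congrArg (coeff (n + 2)) hh
    have e1 := congrArg (coeff (n + 2)) he
    simp only [coeff_add_two_quadratic_mul, coeff_rescale] at h1 e1
    refine (hp (n + 1)).mul_left_cancel ?_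
    simp only [qPochhammer_succ, choose_succ_two] at ih2 ⊢
    linear_combination p ^ (2 * n + 1 + n.choose 2) * h1 -
      qPochhammer (-p) p n * (1 + p ^ (n + 1)) * e1 +
      (a + b) * p ^ (2 * n + 2) * ih2 + (p ^ (2 * n + 2) * (1 + p ^ (n + 1))) * ih1

end FunctionalEquations

/-! ### Rearrangement of the multiple series over a topological ring -/

section Summation

theorem two_mul_choose_two_add (n : ℕ) : 2 * n.choose 2 + n = n ^ 2 := by
  induction n with
  | zero => rfl
  | succ n ih => rw [choose_succ_two]; linarith

/-- Sum a family over the finite fibres of a map. -/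
theorem HasSum.sum_fibers {R α β : Type*} [AddCommMonoid R] [TopologicalSpace R]
    [ContinuousAdd R] [RegularSpace R] {f : α → R} {a : R} (hf : HasSum f a) (g : α → β)
    (s : β → Finset α) (hs : ∀ b x, x ∈ s b ↔ g x = b) :
    HasSum (fun b => ∑ x ∈ s b, f x) a := by
  refine HasSum.sigma ((Equiv.sigmaFiberEquiv g).hasSum_iff.mpr hf) fun b => ?_
  let e : {x // x ∈ s b} ≃ {x // g x = b} := Equiv.subtypeEquivRight (hs b)
  rw [← e.hasSum_iff]
  exact Finset.hasSum (s b) f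

theorem HasSum.sum_antidiagonal {R : Type*} [AddCommMonoid R] [TopologicalSpace R]
    [ContinuousAdd R] [RegularSpace R] {f : ℕ × ℕ → R} {a : R} (hf : HasSum f a) :
    HasSum (fun n => ∑ x ∈ Finset.HasAntidiagonal.antidiagonal n, f x) a :=
  hf.sum_fibers (fun x => x.1 + x.2) _ fun _ _ => Finset.HasAntidiagonal.mem_antidiagonal

/-- A ring `B` of triply indexed "bounded" families, which become summable when multiplied by
`q^(i+j+k)`, and which contains the families built from powers of `q`, from the reciprocals
`1 / (q^k; q^k)_n` and from `(-q^3; q^3)_n`. -/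
structure IsBoundedFamilyRing {R : Type*} [CommRing R] [TopologicalSpace R] (q : R)
    (B : Subring (ℕ × ℕ × ℕ → R)) : Prop where
  summable : ∀ c ∈ B, Summable fun t : ℕ × ℕ × ℕ => q ^ (t.1 + t.2.1 + t.2.2) * c t
  pow_mem : ∀ N : ℕ × ℕ × ℕ → ℕ, (fun t => q ^ N t) ∈ B
  inv_mem : ∀ (k : ℕ) (N : ℕ × ℕ × ℕ → ℕ), (fun t => qPochhammerInv (q ^ (k + 1)) (N t)) ∈ B
  qPochhammer_mem : ∀ N : ℕ × ℕ × ℕ → ℕ, (fun t => qPochhammer (-q ^ 3) (q ^ 3) (N t)) ∈ B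

variable {R : Type*} [CommRing R]

theorem IsBoundedFamilyRing.summable_pow_mul [TopologicalSpace R] {q : R}
    {B : Subring (ℕ × ℕ × ℕ → R)} (hB : IsBoundedFamilyRing q B) {N : ℕ × ℕ × ℕ → ℕ}
    {c : ℕ × ℕ × ℕ → R} (hN : ∀ t, t.1 + t.2.1 + t.2.2 ≤ N t) (hc : c ∈ B) :
    Summable fun t => q ^ N t * c t := by
  refine (hB.summable _ (B.mul_mem (hB.pow_mem fun t => N t - (t.1 + t.2.1 + t.2.2)) hc)).congr
    fun t => ?_
  rw [Pi.mul_apply, ← mul_assoc, ← pow_add, Nat.add_sub_cancel' (hN t)]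

theorem coeff_eulerExp_pow (q : R) (k l n : ℕ) :
    coeff n (eulerExp (q ^ (k + 1)) (q ^ l)) =
      q ^ ((k + 1) * n.choose 2 + l * n) * qPochhammerInv (q ^ (k + 1)) n := by
  rw [eulerExp, coeff_mk, pow_add q (_ * _), pow_mul, pow_mul]

/-- This is multiplication by 1 + xu, evaluated at u = 1. -/
theorem hasSum_coeff_linear_mul [TopologicalSpace R] [IsTopologicalRing R] (x : R) {F : R⟦X⟧} {s : R}
    (hF : HasSum (fun n => coeff n F) s) :
    HasSum (fun n => coeff n ((1 + C x * X) * F)) ((1 + x) * s) := by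
  have h1 := (hasSum_nat_add_iff' 1).mpr hF
  have h2 := h1.add (hF.mul_left x)
  rw [← hasSum_nat_add_iff' 1]
  simp only [coeff_succ_linear_mul, Finset.sum_range_one, coeff_zero_linear_mul] at h2 ⊢
  convert! h2 using 1
  ring

/-- The general term of the triple series that links the double series to the product. -/
noncomputable def productTerm (q : R) (t : ℕ × ℕ × ℕ) : R :=
  coeff t.1 (eulerExp (q ^ 3) (q ^ (3 * (t.2.1 + t.2.2) + 2 + 1))) *
    qPochhammer (-q ^ 3) (q ^ 3) (t.2.1 + t.2.2) *
      (coeff t.2.1 (eulerExp (q ^ 6) (q ^ 2)) * coeff t.2.2 (eulerExp (q ^ 6) (q ^ 4)))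

/-- The triple series, grouped by `j = r + s` in its last two indices. -/
theorem sum_antidiagonal_triple {q : R} (hq : ∀ n, IsUnit (1 - q ^ (n + 1))) (i j : ℕ) :
    ∑ t ∈ Finset.HasAntidiagonal.antidiagonal j, productTerm q (i, t) =
      (q ^ 3) ^ (i + j).choose 2 * (coeff i (eulerInv (q ^ 3) (q ^ 3)) * coeff j
        (eulerExp (q ^ 3) (q ^ 2) * eulerExp (q ^ 3) (q ^ 4) * eulerInvSq (q ^ 6) (q ^ 3))) := by
  have hq3 : ∀ n, IsUnit (1 - (q ^ 3) ^ (n + 1)) := fun n => by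
    rw [← pow_mul]; exact hq (3 * n + 2)
  have h3 : ∀ t ∈ Finset.HasAntidiagonal.antidiagonal j, productTerm q (i, t) =
      coeff i (eulerExp (q ^ 3) (q ^ (3 * j + 2 + 1))) *
        qPochhammer (-q ^ 3) (q ^ 3) j *
          (coeff t.1 (eulerExp (q ^ 6) (q ^ 2)) * coeff t.2 (eulerExp (q ^ 6) (q ^ 4))) :=
    fun t ht => by
      rw [productTerm, Finset.HasAntidiagonal.mem_antidiagonal.mp ht]
  have h4 := pow_choose_mul_coeff_eulerExp hq3 (show q ^ 2 * q ^ 4 = (q ^ 3) ^ 2 by ring) j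
  rw [show (q ^ 3) ^ 2 = q ^ 6 by ring, coeff_mul j (eulerExp (q ^ 6) (q ^ 2))] at h4
  rw [Finset.sum_congr rfl h3, ← Finset.mul_sum, mul_assoc, ← h4, choose_add_two]
  simp only [eulerExp, eulerInv, coeff_mk]
  ring

theorem IsBoundedFamilyRing.summable_productTerm [TopologicalSpace R] {q : R}
    {B : Subring (ℕ × ℕ × ℕ → R)} (hB : IsBoundedFamilyRing q B) :
    Summable (productTerm q) := by
  refine (hB.summable_pow_mul (N := fun t =>
    (2 + 1) * t.1.choose 2 + (3 * (t.2.1 + t.2.2) + 2 + 1) * t.1 +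
      (((5 + 1) * t.2.1.choose 2 + 2 * t.2.1) + ((5 + 1) * t.2.2.choose 2 + 4 * t.2.2)))
    (fun t => by nlinarith [Nat.zero_le ((t.2.1 + t.2.2) * t.1)])
    (B.mul_mem (B.mul_mem (hB.inv_mem 2 fun t => t.1) (hB.qPochhammer_mem fun t => t.2.1 + t.2.2))
      (B.mul_mem (hB.inv_mem 5 fun t => t.2.1) (hB.inv_mem 5 fun t => t.2.2)))).congr fun t => ?_
  simp only [productTerm, coeff_eulerExp_pow q 2, coeff_eulerExp_pow q 5, Pi.mul_apply]
  ring

variable [UniformSpace R] [IsUniformAddGroup R] [CompleteSpace R]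

theorem IsBoundedFamilyRing.summable_pair {q : R}
    {B : Subring (ℕ × ℕ × ℕ → R)} (hB : IsBoundedFamilyRing q B) {N : ℕ × ℕ → ℕ}
    {c : ℕ × ℕ → R} (hN : ∀ t, t.1 + t.2 ≤ N t) (hc : (fun t => c (t.1, t.2.1)) ∈ B) :
    Summable fun t => q ^ N t * c t := by
  -- The third index is a dummy: it enters the exponent for summability and is then set to 0.
  have h := hB.summable_pow_mul (N := fun t => N (t.1, t.2.1) + t.2.2)
    (fun t => Nat.add_le_add_right (hN (t.1, t.2.1)) _) hc
  have hi : Function.Injective fun t : ℕ × ℕ => (t.1, t.2, 0) := by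
    rintro ⟨a, b⟩ ⟨c, d⟩ h
    simpa using h
  simpa [Function.comp_def] using h.comp_injective hi

theorem IsBoundedFamilyRing.summable_eulerExp {q : R}
    {B : Subring (ℕ × ℕ × ℕ → R)} (hB : IsBoundedFamilyRing q B) (k l : ℕ) :
    Summable fun n => coeff n (eulerExp (q ^ (k + 1)) (q ^ (l + 1))) := by
  have h := (hB.summable_pair
    (N := fun t => t.1 + ((k + 1) * t.2.choose 2 + (l + 1) * t.2))
    (c := fun t => qPochhammerInv (q ^ (k + 1)) t.2)
    (fun t => by nlinarith [Nat.zero_le (l * t.2), Nat.zero_le ((k + 1) * t.2.choose 2)])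
    (hB.inv_mem k fun t => t.2.1)).prod_factor 0
  refine h.congr fun n => ?_
  rw [coeff_eulerExp_pow, zero_add]

variable [T2Space R] [IsTopologicalRing R]

/-- The functional equation `eulerExp_eq` at u = 1, applied m times. -/
theorem IsBoundedFamilyRing.tsum_eulerExp_eq {q : R}
    {B : Subring (ℕ × ℕ × ℕ → R)} (hB : IsBoundedFamilyRing q B)
    (hq : ∀ n, IsUnit (1 - q ^ (n + 1))) (k l m : ℕ) :
    ∑' n, coeff n (eulerExp (q ^ (k + 1)) (q ^ (l + 1))) =
      qPochhammer (-q ^ (l + 1)) (q ^ (k + 1)) m *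
        ∑' n, coeff n (eulerExp (q ^ (k + 1)) (q ^ ((k + 1) * m + l + 1))) := by
  have hk : ∀ n, IsUnit (1 - (q ^ (k + 1)) ^ (n + 1)) := fun n => by
    rw [← pow_mul]; exact hq ((k + 1) * n + k)
  induction m with
  | zero => simp [qPochhammer]
  | succ m ih =>
    have h := (hasSum_coeff_linear_mul (q ^ ((k + 1) * m + l + 1))
      (hB.summable_eulerExp k ((k + 1) * (m + 1) + l)).hasSum).tsum_eq
    rw [ih, eulerExp_eq hk, ← pow_add,
      show k + 1 + ((k + 1) * m + l + 1) = (k + 1) * (m + 1) + l + 1 by ring, h,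
      qPochhammer_succ]
    ring

/-- Euler's expansion of `(-x; t)_∞` for `x` and `t` positive powers of `q`. -/
theorem IsBoundedFamilyRing.hasSum_eulerExp {q : R}
    {B : Subring (ℕ × ℕ × ℕ → R)} (hB : IsBoundedFamilyRing q B)
    (hq : ∀ n, IsUnit (1 - q ^ (n + 1)))
    (hlim : ∀ (a : R) (k : ℕ), Tendsto (qPochhammer a (q ^ (k + 1))) atTop
      (𝓝 (qPochhammerInf a (q ^ (k + 1))))) (k l : ℕ) :
    HasSum (fun n => coeff n (eulerExp (q ^ (k + 1)) (q ^ (l + 1))))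
      (qPochhammerInf (-q ^ (l + 1)) (q ^ (k + 1))) := by
  -- Joint summability over m and n ≥ 1 makes the row sums tend to 0 as m grows. So the series left
  -- after removing m factors tends to its constant term 1.
  have hs : Summable fun t : ℕ × ℕ =>
      coeff (t.2 + 1) (eulerExp (q ^ (k + 1)) (q ^ ((k + 1) * t.1 + l + 1))) := by
    simp only [coeff_eulerExp_pow]
    exact hB.summable_pair
      (c := fun t => qPochhammerInv (q ^ (k + 1)) (t.2 + 1))
      (fun t => by
        nlinarith [Nat.zero_le (k * t.1), Nat.zero_le ((k + 1) * t.1 * t.2), Nat.zero_le (l * t.2),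
          Nat.zero_le ((k + 1) * (t.2 + 1).choose 2)])
      (hB.inv_mem k fun t => t.2.1 + 1)
  have h0 := (hs.hasSum.prod_fiberwise fun m => (hs.prod_factor m).hasSum).summable
    |>.tendsto_atTop_zero
  have h1 : Tendsto (fun m => ∑' n, coeff n (eulerExp (q ^ (k + 1)) (q ^ ((k + 1) * m + l + 1))))
      atTop (𝓝 1) := by
    have h2 := h0.const_add 1
    rw [add_zero] at h2
    refine h2.congr fun m => ?_
    rw [(hB.summable_eulerExp k ((k + 1) * m + l)).tsum_eq_zero_add]
    simp [eulerExp]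
  have h2 := (hlim (-q ^ (l + 1)) k).mul h1
  simp only [← hB.tsum_eulerExp_eq hq, mul_one] at h2
  rw [tendsto_nhds_unique h2 tendsto_const_nhds]
  exact (hB.summable_eulerExp k l).hasSum

theorem IsBoundedFamilyRing.hasSum_productTerm {q : R}
    {B : Subring (ℕ × ℕ × ℕ → R)} (hB : IsBoundedFamilyRing q B)
    (hq : ∀ n, IsUnit (1 - q ^ (n + 1)))
    (hlim : ∀ (a : R) (k : ℕ), Tendsto (qPochhammer a (q ^ (k + 1))) atTop
      (𝓝 (qPochhammerInf a (q ^ (k + 1))))) :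
    HasSum (productTerm q)
      (qPochhammerInf (-q ^ 2) (q ^ 6) * qPochhammerInf (-q ^ 4) (q ^ 6) *
        qPochhammerInf (-q ^ 3) (q ^ 3)) := by
  have hes : Summable fun t : ℕ × ℕ =>
      coeff t.1 (eulerExp (q ^ 6) (q ^ 2)) * coeff t.2 (eulerExp (q ^ 6) (q ^ 4)) := by
    refine (hB.summable_pair (N := fun t =>
        ((5 + 1) * t.1.choose 2 + 2 * t.1) + ((5 + 1) * t.2.choose 2 + 4 * t.2))
      (c := fun t => qPochhammerInv (q ^ (5 + 1)) t.1 * qPochhammerInv (q ^ (5 + 1)) t.2)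
      (fun t => by linarith)
      (B.mul_mem (hB.inv_mem 5 fun t => t.1) (hB.inv_mem 5 fun t => t.2.1))).congr fun t => ?_
    simp only [coeff_eulerExp_pow q 5]
    ring
  have hE := (hB.hasSum_eulerExp hq hlim 5 1).mul (hB.hasSum_eulerExp hq hlim 5 3) hes
  have h1 := ((Equiv.prodComm (ℕ × ℕ) ℕ).hasSum_iff.mpr
    hB.summable_productTerm.hasSum).prod_fiberwise
      (g := fun t => coeff t.1 (eulerExp (q ^ 6) (q ^ 2)) * coeff t.2 (eulerExp (q ^ 6) (q ^ 4)) *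
        qPochhammerInf (-q ^ 3) (q ^ 3)) fun t => by
    -- With r and s fixed, the sum over i supplies exactly the factors of (-q³;q³)_∞ beyond the
    -- first r + s.
    have h2 := hB.tsum_eulerExp_eq hq 2 2 (t.1 + t.2)
    rw [(hB.hasSum_eulerExp hq hlim 2 2).tsum_eq] at h2
    have h3 := ((hB.summable_eulerExp 2 (3 * (t.1 + t.2) + 2)).hasSum.mul_right
      (qPochhammer (-q ^ 3) (q ^ 3) (t.1 + t.2))).mul_right
        (coeff t.1 (eulerExp (q ^ 6) (q ^ 2)) * coeff t.2 (eulerExp (q ^ 6) (q ^ 4)))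
    rw [h2]
    convert! h3 using 1
    ring
  have h4 := h1.unique (hE.mul_right _)
  simp only [Nat.reduceAdd] at h4
  rw [← h4]
  exact hB.summable_productTerm.hasSum

/-- Grouped by the degree k in u, the double and triple series have the same terms, so uniqueness of
sums transfers the value. -/
theorem IsBoundedFamilyRing.hasSum_double_series {q : R}
    {B : Subring (ℕ × ℕ × ℕ → R)} (hB : IsBoundedFamilyRing q B)
    (hq : ∀ n, IsUnit (1 - q ^ (n + 1)))
    (hlim : ∀ (a : R) (k : ℕ), Tendsto (qPochhammer a (q ^ (k + 1))) atTop
      (𝓝 (qPochhammerInf a (q ^ (k + 1))))) :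
    HasSum (fun p : ℕ × ℕ => q ^ (2 * p.1 ^ 2 + 6 * p.1 * p.2 + 6 * p.2 ^ 2) *
        (qPochhammerInv q p.1 * qPochhammerInv (q ^ 3) p.2))
      (qPochhammerInf (-q ^ 2) (q ^ 6) * qPochhammerInf (-q ^ 4) (q ^ 6) *
        qPochhammerInf (-q ^ 3) (q ^ 3)) := by
  have h1 := ((hB.hasSum_productTerm hq hlim).sum_fibers (fun t => (t.1, t.2.1 + t.2.2))
    (fun t => {t.1} ×ˢ Finset.HasAntidiagonal.antidiagonal t.2) (by
      rintro ⟨i, j⟩ ⟨i', r, s⟩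
      simp [and_comm, eq_comm])).sum_antidiagonal
  simp only [Finset.sum_product, Finset.sum_singleton, sum_antidiagonal_triple hq] at h1
  have hDs : Summable fun p : ℕ × ℕ => q ^ (2 * p.1 ^ 2 + 6 * p.1 * p.2 + 6 * p.2 ^ 2) *
      (qPochhammerInv q p.1 * qPochhammerInv (q ^ 3) p.2) := by
    refine hB.summable_pair (c := fun p => qPochhammerInv q p.1 * qPochhammerInv (q ^ 3) p.2)
      (fun t => ?_) (B.mul_mem ?_ (hB.inv_mem 2 fun t => t.2.1))
    · nlinarith [Nat.zero_le (t.1 * t.2), Nat.le_self_pow two_ne_zero t.1,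
        Nat.le_self_pow two_ne_zero t.2]
    · simpa using hB.inv_mem 0 fun t => t.1
  -- The second index of D is the degree 2n in u. Odd degrees contribute 0, so D has the same sum as
  -- the double series.
  set D : ℕ × ℕ → R := fun t => (q ^ 3) ^ (t.1 + t.2).choose 2 *
    (coeff t.1 (eulerExp q (q ^ 2)) * coeff t.2 (eulerInvSq (q ^ 3) (q ^ 3))) with hD
  have hinj : Function.Injective fun t : ℕ × ℕ => (t.1, 2 * t.2) := by
    rintro ⟨a, b⟩ ⟨c, d⟩ h
    simpa using h
  have hD2 : (fun p : ℕ × ℕ => q ^ (2 * p.1 ^ 2 + 6 * p.1 * p.2 + 6 * p.2 ^ 2) *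
      (qPochhammerInv q p.1 * qPochhammerInv (q ^ 3) p.2)) = D ∘ fun t => (t.1, 2 * t.2) := by
    funext ⟨m, n⟩
    have h3 : 2 * m ^ 2 + 6 * m * n + 6 * n ^ 2 =
        3 * (m + 2 * n).choose 2 + m.choose 2 + 2 * m + 3 * n := by
      nlinarith [two_mul_choose_two_add m, two_mul_choose_two_add (m + 2 * n)]
    simp only [hD, Function.comp_apply, eulerExp, eulerInvSq, coeff_mk, h3, even_two_mul, if_true,
      Nat.mul_div_cancel_left _ two_pos]
    ring
  rw [hD2] at hDs ⊢
  have hD3 : HasSum D (∑' t : ℕ × ℕ, D (t.1, 2 * t.2)) := by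
    refine (hinj.hasSum_iff fun t ht => ?_).mp hDs.hasSum
    have h3 : ¬ Even t.2 := fun h => ht (by
      obtain ⟨n, hn⟩ := h
      exact ⟨(t.1, n), by simp [two_mul, ← hn]⟩)
    simp [hD, eulerInvSq, h3]
  have h5 := hD3.sum_antidiagonal
  have h6 (k : ℕ) : ∑ x ∈ Finset.HasAntidiagonal.antidiagonal k, D x =
      (q ^ 3) ^ k.choose 2 * coeff k (eulerInv (q ^ 3) (q ^ 3) *
        (eulerExp (q ^ 3) (q ^ 2) * eulerExp (q ^ 3) (q ^ 4) * eulerInvSq (q ^ 6) (q ^ 3))) := by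
    rw [← eulerExp_mul_eulerInvSq hq, coeff_mul, Finset.mul_sum]
    refine Finset.sum_congr rfl fun x hx => ?_
    simp only [hD, Finset.HasAntidiagonal.mem_antidiagonal.mp hx]
  have h7 (k : ℕ) : ∑ x ∈ Finset.HasAntidiagonal.antidiagonal k,
      (q ^ 3) ^ (x.1 + x.2).choose 2 * (coeff x.1 (eulerInv (q ^ 3) (q ^ 3)) * coeff x.2
        (eulerExp (q ^ 3) (q ^ 2) * eulerExp (q ^ 3) (q ^ 4) * eulerInvSq (q ^ 6) (q ^ 3))) =
      (q ^ 3) ^ k.choose 2 * coeff k (eulerInv (q ^ 3) (q ^ 3) *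
        (eulerExp (q ^ 3) (q ^ 2) * eulerExp (q ^ 3) (q ^ 4) * eulerInvSq (q ^ 6) (q ^ 3))) := by
    rw [coeff_mul, Finset.mul_sum]
    refine Finset.sum_congr rfl fun x hx => ?_
    rw [Finset.HasAntidiagonal.mem_antidiagonal.mp hx]
  simp only [h6] at h5
  simp only [h7] at h1
  rw [h1.unique h5]
  exact hDs.hasSum

end Summation

/-! ### The complex case -/

section Complex

/-- The ring of bounded complex families. -/
def boundedComplexFamilies (ι : Type*) : Subring (ι → ℂ) where
  carrier := {c | ∃ M : ℝ, ∀ t, ‖c t‖ ≤ M}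
  zero_mem' := ⟨0, fun t => by simp⟩
  one_mem' := ⟨1, fun t => by simp⟩
  add_mem' := by
    rintro f g ⟨M, hM⟩ ⟨N, hN⟩
    exact ⟨M + N, fun t => (norm_add_le _ _).trans (add_le_add (hM t) (hN t))⟩
  mul_mem' := by
    rintro f g ⟨M, hM⟩ ⟨N, hN⟩
    refine ⟨M * N, fun t => ?_⟩
    rw [Pi.mul_apply, norm_mul]
    exact mul_le_mul (hM t) (hN t) (norm_nonneg _) ((norm_nonneg _).trans (hM t))
  neg_mem' := by
    rintro f ⟨M, hM⟩
    exact ⟨M, fun t => by simpa using hM t⟩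

theorem comp_mem_boundedComplexFamilies {ι : Type*} {u : ℕ → ℂ} {a : ℂ}
    (hu : Tendsto u atTop (𝓝 a)) (N : ι → ℕ) :
    (fun t => u (N t)) ∈ boundedComplexFamilies ι := by
  obtain ⟨M, hM⟩ := (Metric.isBounded_range_of_tendsto u hu).exists_norm_le
  exact ⟨M, fun t => hM _ ⟨N t, rfl⟩⟩

/-- A nonzero limit makes the reciprocals 1/(t;t)_n converge, hence stay bounded. -/
theorem qPochhammerInf_self_ne_zero {t : ℂ} (ht : ‖t‖ < 1) : qPochhammerInf t t ≠ 0 := by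
  have h := tprod_one_add_ne_zero_of_summable (R := ℂ) (f := fun i : ℕ => -(t * t ^ i))
    (fun i h => ?_) ?_
  · simpa [qPochhammerInf, sub_eq_add_neg] using h
  · rw [← pow_succ', ← sub_eq_add_neg, sub_eq_zero] at h
    have h1 := congrArg norm h
    rw [norm_one, norm_pow] at h1
    exact (pow_lt_one₀ (norm_nonneg t) ht i.succ_ne_zero).ne' h1
  · simpa [norm_mul, norm_pow] using
      (summable_geometric_of_lt_one (norm_nonneg t) ht).mul_left ‖t‖

theorem norm_pow_succ_lt_one {q : ℂ} (hq : ‖q‖ < 1) (k : ℕ) : ‖q ^ (k + 1)‖ < 1 := by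
  rw [norm_pow]; exact pow_lt_one₀ (norm_nonneg q) hq k.succ_ne_zero

theorem isBoundedFamilyRing_complex {q : ℂ} (hq : ‖q‖ < 1) :
    IsBoundedFamilyRing q (boundedComplexFamilies (ℕ × ℕ × ℕ)) where
  summable := by
    rintro c ⟨M, hM⟩
    have hg := summable_geometric_of_lt_one (norm_nonneg q) hq
    have hnn : (0 : ℕ → ℝ) ≤ fun n => ‖q‖ ^ n := fun n => pow_nonneg (norm_nonneg q) n
    have hg3 := hg.mul_of_nonneg (hg.mul_of_nonneg hg hnn hnn) hnn
      fun t => mul_nonneg (hnn t.1) (hnn t.2)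
    refine Summable.of_norm_bounded (hg3.mul_right M) fun t => ?_
    rw [norm_mul, norm_pow, add_assoc, pow_add, pow_add]
    exact mul_le_mul_of_nonneg_left (hM t) (mul_nonneg (hnn _) (mul_nonneg (hnn _) (hnn _)))
  pow_mem N := comp_mem_boundedComplexFamilies (tendsto_pow_atTop_nhds_zero_of_norm_lt_one hq) N
  inv_mem k N := by
    have ht := norm_pow_succ_lt_one hq k
    have h := (tendsto_qPochhammer_complex (q ^ (k + 1)) (q ^ (k + 1)) ht).inv₀
      (qPochhammerInf_self_ne_zero ht)
    simpa only [qPochhammerInv, Ring.inverse_eq_inv] using comp_mem_boundedComplexFamilies h N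
  qPochhammer_mem N := comp_mem_boundedComplexFamilies
    (tendsto_qPochhammer_complex _ _ (norm_pow_succ_lt_one hq 2)) N

end Complex

/-! ### The formal case and the conclusion -/

theorem isBoundedFamilyRing_formal : IsBoundedFamilyRing (X : ℤ⟦X⟧) ⊤ where
  summable c _ := by
    rw [WithPiTopology.summable_iff_summable_coeff]
    intro d
    -- Only indices with i + j + k ≤ d reach degree d, so every family is admissible.
    refine summable_of_hasFiniteSupport
      (((Set.finite_Iic d).prod ((Set.finite_Iic d).prod (Set.finite_Iic d))).subset fun t ht => ?_)
    have h : t.1 + t.2.1 + t.2.2 ≤ d := by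
      by_contra h
      exact ht (by simp only [coeff_X_pow_mul', if_neg h])
    simp only [Set.mem_prod, Set.mem_Iic]
    omega
  pow_mem _ := trivial
  inv_mem _ _ := trivial
  qPochhammer_mem _ := trivial

theorem mainTheorem7 :
    (∀ q : ℂ, ‖q‖ < 1 →
      HasSum
        (fun p : ℕ × ℕ =>
          q ^ (2 * p.1 ^ 2 + 6 * p.1 * p.2 + 6 * p.2 ^ 2) /
            (qPochhammer q q p.1 * qPochhammer (q ^ 3) (q ^ 3) p.2))
        (qPochhammerInf (-q ^ 2) (q ^ 6) * qPochhammerInf (-q ^ 4) (q ^ 6) *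
          qPochhammerInf (-q ^ 3) (q ^ 3))) ∧
    HasSum
      (fun p : ℕ × ℕ =>
        (X : ℤ⟦X⟧) ^ (2 * p.1 ^ 2 + 6 * p.1 * p.2 + 6 * p.2 ^ 2) *
          Ring.inverse (qPochhammer X X p.1 * qPochhammer (X ^ 3) (X ^ 3) p.2))
      (qPochhammerInf (-X ^ 2) (X ^ 6) * qPochhammerInf (-X ^ 4) (X ^ 6) *
        qPochhammerInf (-X ^ 3) (X ^ 3)) := by
  constructor
  · intro q hq
    have h := (isBoundedFamilyRing_complex hq).hasSum_double_series
      (fun n => by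
        rw [isUnit_iff_ne_zero, sub_ne_zero]
        intro h
        simpa [← h] using norm_pow_succ_lt_one hq n)
      (fun a k => tendsto_qPochhammer_complex a _ (norm_pow_succ_lt_one hq k))
    simpa only [qPochhammerInv, Ring.inverse_eq_inv, div_eq_mul_inv, mul_inv] using h
  · have h := isBoundedFamilyRing_formal.hasSum_double_series
      (fun n => by rw [PowerSeries.isUnit_iff_constantCoeff]; simp)
      (fun a k => tendsto_qPochhammer_formal a _ (by simp))
    simpa only [qPochhammerInv, ← Ring.mul_inverse_rev, mul_comm (qPochhammer (X ^ 3) _ _)]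
      using h
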